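/- Let $K$ denote prefix-free Kolmogorov complexity: fix any optimal (universal) prefix-free machine $U$, i.e. a partial computable function $U$ from binary strings to binary strings with prefix-free domain such that for every partial computable $M$ with prefix-free domain there is a constant $d$ such that whenever $M(\sigma)=x$ there is $\tau$ with $U(\tau)=x$ and $|\tau|\le|\sigma|+d$; let $K(x)$ be the least length of a string $\sigma$ with $U(\sigma)=x$, and for $n\in\mathbb N$ let $K(n)$ be $K$ of the $n$-th binary string in length-lexicographic order. Let $\mu$ be a Borel probability measure on Cantor space $\{0,1\}^{\mathbb N}$, and write $\mu[x]$ for the measure of the set of infinite sequences extending the string $x$. Suppose that $\mu$ is $K$-trivial: there is a constant $c$ such that for all $n\in\mathbb N$ $$\sum_{|x|=n} K(x)\,\mu[x]\;\le\; K(n)+c .$$ Then $\mu$ has atoms, i.e. there is a point $Z$ with $\mu(\{Z\})>0$. In fact, $\mu$ is concentrated on its atoms: $\mu\big(\{0,1\}^{\mathbb N}\setminus\{Z:\mu(\{Z\})>0\}\big)=0$. -/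

import Mathlib

open MeasureTheory

/-- A prefix-free machine: a partial recursive function from binary strings to binary strings
whose domain is prefix-free. -/
structure IsPrefixFreeMachine (M : List Bool →. List Bool) : Prop where
  partrec : Partrec M
  prefixFree : ∀ σ τ : List Bool, (M σ).Dom → (M τ).Dom → σ <+: τ → σ = τ

/-- An optimal (universal) prefix-free machine `U`: every prefix-free machine `M` is simulated by
`U` with descriptions that are longer by at most an additive constant depending on `M`. -/
structure IsOptimalPrefixFreeMachine (U : List Bool →. List Bool) : Prop where
  machine : IsPrefixFreeMachine U
  optimal : ∀ M : List Bool →. List Bool, IsPrefixFreeMachine M →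
    ∃ d : ℕ, ∀ σ x : List Bool, x ∈ M σ → ∃ τ : List Bool, x ∈ U τ ∧ τ.length ≤ σ.length + d

/-- Prefix-free Kolmogorov complexity of the string `x` with respect to the machine `U`: the least
length of a `U`-description of `x`. -/
noncomputable def prefixComplexity (U : List Bool →. List Bool) (x : List Bool) : ℕ :=
  sInf {l : ℕ | ∃ σ : List Bool, x ∈ U σ ∧ σ.length = l}

/-- The standard (length-lexicographic) identification of natural numbers with binary strings:
`n` is the binary expansion of `n + 1`, most significant digit first, without its leading `1`. -/
def natString (n : ℕ) : List Bool := (Nat.bits (n + 1)).dropLast.reverse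

/-- The cylinder `[x]` of all infinite binary sequences that extend the string `x`. -/
def cantorCylinder (x : List Bool) : Set (ℕ → Bool) :=
  {Z | ∀ (i : ℕ) (h : i < x.length), Z i = x[i]}

/-- `K(μ ↾ n)`: the `μ`-average of the complexities `K(x)` over all strings `x` of length `n`. -/
noncomputable def averageComplexity (U : List Bool →. List Bool) (μ : Measure (ℕ → Bool))
    (n : ℕ) : ℝ :=
  ∑ x : Fin n → Bool,
    (prefixComplexity U (List.ofFn x) : ℝ) * μ.real (cantorCylinder (List.ofFn x))

/-- `μ` is `K`-trivial: `K(μ ↾ n) ≤ K(n) + O(1)`. -/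
def IsKTrivialMeasure (U : List Bool →. List Bool) (μ : Measure (ℕ → Bool)) : Prop :=
  ∃ c : ℕ, ∀ n : ℕ, averageComplexity U μ n ≤ (prefixComplexity U (natString n) : ℝ) + c

/-- The atoms of a measure on Cantor space: the points of positive measure. -/
def measureAtoms (μ : Measure (ℕ → Bool)) : Set (ℕ → Bool) := {Z | 0 < μ {Z}}

/-- Every string has a description, so the infimum defining its complexity is attained. -/
theorem IsOptimalPrefixFreeMachine.exists_description {U : List Bool →. List Bool}
    (hU : IsOptimalPrefixFreeMachine U) (x : List Bool) :
    ∃ σ : List Bool, x ∈ U σ ∧ σ.length = prefixComplexity U x := by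
  have hM : IsPrefixFreeMachine (fun σ => if σ = [] then Part.some x else Part.none) := by
    refine ⟨?_, ?_⟩
    · have h : Partrec fun σ : List Bool =>
          ((if σ = [] then some x else none : Option (List Bool)) : Part (List Bool)) :=
        Computable.ofOption
          (Primrec.ite (Primrec.eq.comp Primrec.id (Primrec.const []))
            (Primrec.const (some x)) (Primrec.const none)).to_comp
      refine h.of_eq fun σ => ?_
      split_ifs <;> rfl
    · intro σ τ h1 h2 _
      by_cases h3 : σ = []
      · by_cases h4 : τ = []
        · rw [h3, h4]
        · simp [h4] at h2
      · simp [h3] at h1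
  obtain ⟨d, hd⟩ := hU.optimal _ hM
  obtain ⟨τ, hτ, -⟩ := hd [] x (by simp)
  exact Nat.sInf_mem (s := {l : ℕ | ∃ σ : List Bool, x ∈ U σ ∧ σ.length = l}) ⟨_, τ, hτ, rfl⟩

namespace OptimalMachine

/-- Splits `1^e 0 σ` into `(e, σ)`. -/
def parse (p : List Bool) : Option (ℕ × List Bool) :=
  if p.findIdx (fun b => !b) < p.length then
    some (p.findIdx (fun b => !b), p.drop (p.findIdx (fun b => !b) + 1)) else none

theorem parse_eq_some {p σ : List Bool} {e : ℕ} :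
    parse p = some (e, σ) ↔ p = List.replicate e true ++ false :: σ := by
  induction p generalizing e with
  | nil => simp [parse]
  | cons b t ih =>
    cases b with
    | false =>
      cases e with
      | zero => simp [parse, List.findIdx_cons]
      | succ e => simp [parse, List.findIdx_cons, List.replicate_succ]
    | true =>
      cases e with
      | zero =>
        simp [parse, List.findIdx_cons]
      | succ e =>
        rw [List.replicate_succ, List.cons_append, List.cons.injEq, ← ih]
        simp [parse, List.findIdx_cons]

theorem parse_primrec : Primrec parse := by
  have hi : Primrec fun p : List Bool => p.findIdx (fun b => !b) :=
    Primrec.list_findIdx Primrec.id (Primrec.not.comp Primrec.snd)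
  exact Primrec.ite (Primrec.nat_lt.comp hi Primrec.list_length)
    (Primrec.option_some.comp
      (Primrec.pair hi (Primrec.list_drop.comp (Primrec.succ.comp hi) Primrec.id)))
    (Primrec.const none)

/-- The inputs `σ ≠ τ` are comparable. -/
def Comp (σ τ : List Bool) : Prop :=
  σ ≠ τ ∧ (σ = τ.take σ.length ∨ τ = σ.take τ.length)

instance (σ τ : List Bool) : Decidable (Comp σ τ) := by unfold Comp; infer_instance

/-- Some input that is comparable with `σ` is seen to halt within `k` steps of program `e`. -/
def Conflict (m : ℕ) (a : (ℕ × List Bool) × ℕ) : Prop :=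
  ((Nat.Partrec.Code.evaln a.2 (Denumerable.ofNat Nat.Partrec.Code a.1.1) m).isSome = true) ∧
    Comp a.1.2 ((Encodable.decode (α := List Bool) m).getD a.1.2)

instance (m : ℕ) (a : (ℕ × List Bool) × ℕ) : Decidable (Conflict m a) := by
  unfold Conflict; infer_instance

/-- One stage of the machine with index `e`, thinned out so that its domain is prefix-free. -/
def stage (a : ℕ × List Bool) (k : ℕ) : Option (List Bool) :=
  if ∃ m < k, Conflict m (a, k) then none else
    (Nat.Partrec.Code.evaln k (Denumerable.ofNat Nat.Partrec.Code a.1)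
      (Encodable.encode a.2)).bind fun v => Encodable.decode (α := List Bool) v

theorem conflict_primrec : PrimrecRel Conflict := by
  have hev : Primrec fun x : ℕ × ((ℕ × List Bool) × ℕ) =>
      Nat.Partrec.Code.evaln x.2.2 (Denumerable.ofNat Nat.Partrec.Code x.2.1.1) x.1 :=
    Nat.Partrec.Code.primrec_evaln.comp
      (Primrec.pair (Primrec.pair (Primrec.snd.comp Primrec.snd)
        ((Primrec.ofNat _).comp (Primrec.fst.comp (Primrec.fst.comp Primrec.snd)))) Primrec.fst)
  have hs : Primrec fun x : ℕ × ((ℕ × List Bool) × ℕ) => x.2.1.2 :=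
    Primrec.snd.comp (Primrec.fst.comp Primrec.snd)
  have ht : Primrec fun x : ℕ × ((ℕ × List Bool) × ℕ) =>
      (Encodable.decode (α := List Bool) x.1).getD x.2.1.2 :=
    Primrec.option_getD.comp (Primrec.decode.comp Primrec.fst) hs
  have h1 : PrimrecPred fun x : ℕ × ((ℕ × List Bool) × ℕ) =>
      (Nat.Partrec.Code.evaln x.2.2 (Denumerable.ofNat Nat.Partrec.Code x.2.1.1) x.1).isSome
        = true :=
    Primrec.eq.comp (Primrec.option_isSome.comp hev) (Primrec.const true)
  refine h1.and (PrimrecPred.and (PrimrecPred.not (Primrec.eq.comp hs ht)) ?_)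
  exact PrimrecPred.or
    (Primrec.eq.comp hs (Primrec.list_take.comp (Primrec.list_length.comp hs) ht))
    (Primrec.eq.comp ht (Primrec.list_take.comp (Primrec.list_length.comp ht) hs))

theorem stage_primrec : Primrec₂ stage := by
  have h1 : PrimrecPred fun a : (ℕ × List Bool) × ℕ => ∃ m < a.2, Conflict m a :=
    PrimrecPred.of_eq
      (PrimrecRel.comp (PrimrecRel.exists_mem_list conflict_primrec)
        (Primrec.list_range.comp Primrec.snd) Primrec.id) (by simp)
  refine Primrec.ite h1 (Primrec.const none) (Primrec.option_bind ?_ ?_)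
  · exact Nat.Partrec.Code.primrec_evaln.comp
      (Primrec.pair (Primrec.pair Primrec.snd
        ((Primrec.ofNat _).comp (Primrec.fst.comp Primrec.fst)))
        (Primrec.encode.comp (Primrec.snd.comp Primrec.fst)))
  · exact Primrec.decode.comp Primrec.snd

/-- The machine with index `e`, thinned out. -/
def run (a : ℕ × List Bool) : Part (List Bool) := Nat.rfindOpt (stage a)

/-- On input `1^e 0 σ`, run the thinned-out machine with index `e` on `σ`. -/
def machine (p : List Bool) : Part (List Bool) := (parse p : Part (ℕ × List Bool)).bind run

theorem machine_partrec : Partrec machine :=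
  (Computable.ofOption parse_primrec.to_comp).bind
    ((Partrec.rfindOpt stage_primrec.to_comp).comp Computable.snd)

theorem run_prefixFree {e : ℕ} {σ τ : List Bool} (h1 : (run (e, σ)).Dom) (h2 : (run (e, τ)).Dom)
    (h : σ <+: τ) : σ = τ := by
  by_contra hne
  obtain ⟨k, x, hx⟩ := Nat.rfindOpt_dom.1 h1
  obtain ⟨l, y, hy⟩ := Nat.rfindOpt_dom.1 h2
  have ht : σ = τ.take σ.length := List.prefix_iff_eq_take.1 h
  unfold stage at hx hy
  split_ifs at hx with c1
  · simp at hx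
  split_ifs at hy with c2
  · simp at hy
  obtain ⟨u, hu, -⟩ := Option.bind_eq_some_iff.1 hx
  obtain ⟨v, hv, -⟩ := Option.bind_eq_some_iff.1 hy
  rcases le_total k l with hkl | hkl
  · have hu' := Nat.Partrec.Code.evaln_mono hkl hu
    refine c2 ⟨Encodable.encode σ, Nat.Partrec.Code.evaln_bound hu', ?_, ?_⟩
    · exact Option.isSome_iff_exists.2 ⟨u, hu'⟩
    · simpa [Comp, Ne.symm hne] using Or.inr ht
  · have hv' := Nat.Partrec.Code.evaln_mono hkl hv
    refine c1 ⟨Encodable.encode τ, Nat.Partrec.Code.evaln_bound hv', ?_, ?_⟩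
    · exact Option.isSome_iff_exists.2 ⟨v, hv'⟩
    · simpa [Comp, hne] using Or.inl ht

theorem machine_prefixFree (p q : List Bool) (hp : (machine p).Dom) (hq : (machine q).Dom)
    (h : p <+: q) : p = q := by
  obtain ⟨x, hx⟩ := Part.dom_iff_mem.1 hp
  obtain ⟨y, hy⟩ := Part.dom_iff_mem.1 hq
  obtain ⟨⟨e, σ⟩, h1, h1'⟩ := Part.mem_bind_iff.1 hx
  obtain ⟨⟨e', τ⟩, h2, h2'⟩ := Part.mem_bind_iff.1 hy
  rw [Part.mem_coe] at h1 h2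
  have hp' := parse_eq_some.1 h1
  have hq' := parse_eq_some.1 h2
  obtain ⟨t, rfl⟩ := h
  have h3 : parse (p ++ t) = some (e, σ ++ t) := parse_eq_some.2 (by rw [hp']; simp)
  have h4 := Option.some.inj (h3.symm.trans h2)
  obtain ⟨rfl, rfl⟩ := Prod.mk.inj h4
  have h5 := run_prefixFree (Part.dom_iff_mem.2 ⟨x, h1'⟩) (Part.dom_iff_mem.2 ⟨y, h2'⟩)
    (List.prefix_append σ t)
  simpa using h5

theorem run_complete {M : List Bool →. List Bool} (hM : IsPrefixFreeMachine M) :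
    ∃ e : ℕ, ∀ σ x : List Bool, x ∈ M σ → x ∈ run (e, σ) := by
  obtain ⟨c, hc⟩ := Nat.Partrec.Code.exists_code.1 hM.partrec
  have hev : ∀ (σ : List Bool) (v : ℕ), v ∈ c.eval (Encodable.encode σ) ↔
      ∃ x ∈ M σ, Encodable.encode x = v := by
    intro σ v
    rw [hc]
    simp
  have hno : ∀ (σ : List Bool) (k : ℕ), (M σ).Dom →
      ¬ ∃ m < k, Conflict m ((Encodable.encode c, σ), k) := by
    rintro σ k hσ ⟨m, -, h1, h2⟩
    obtain ⟨v, hv⟩ := Option.isSome_iff_exists.1 h1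
    simp only [Denumerable.ofNat_encode] at hv
    have hv := Nat.Partrec.Code.evaln_sound hv
    cases hm : Encodable.decode (α := List Bool) m with
    | none => simp [hm, Comp] at h2
    | some τ =>
      rw [hc] at hv
      simp only [hm, Option.getD_some] at h2
      have hτ : (M τ).Dom := by
        simp [hm] at hv
        obtain ⟨x, hx, -⟩ := hv
        exact Part.dom_iff_mem.2 ⟨x, hx⟩
      rcases h2.2 with h3 | h3
      · exact h2.1 (hM.prefixFree _ _ hσ hτ (List.prefix_iff_eq_take.2 h3))
      · exact h2.1 (hM.prefixFree _ _ hτ hσ (List.prefix_iff_eq_take.2 h3)).symm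
  refine ⟨Encodable.encode c, fun σ x hx => ?_⟩
  have hσ : (M σ).Dom := Part.dom_iff_mem.2 ⟨x, hx⟩
  have hst : ∀ k y, y ∈ stage (Encodable.encode c, σ) k → y = x := by
    intro k y hy
    unfold stage at hy
    rw [if_neg (hno σ k hσ)] at hy
    obtain ⟨v, hv, hy⟩ := Option.bind_eq_some_iff.1 hy
    simp only [Denumerable.ofNat_encode] at hv
    obtain ⟨z, hz, rfl⟩ := (hev σ v).1 (Nat.Partrec.Code.evaln_sound hv)
    rw [Encodable.encodek] at hy
    exact (Option.some.inj hy).symm.trans (Part.mem_unique hz hx)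
  obtain ⟨k, hk⟩ := Nat.Partrec.Code.evaln_complete.1 ((hev σ _).2 ⟨x, hx, rfl⟩)
  have hxk : x ∈ stage (Encodable.encode c, σ) k := by
    unfold stage
    rw [if_neg (hno σ k hσ)]
    refine Option.bind_eq_some_iff.2 ⟨_, ?_, Encodable.encodek x⟩
    rw [Denumerable.ofNat_encode]
    exact hk
  have hd : (run (Encodable.encode c, σ)).Dom := Nat.rfindOpt_dom.2 ⟨k, x, hxk⟩
  obtain ⟨y, hy⟩ := Part.dom_iff_mem.1 hd
  obtain ⟨l, hl⟩ := Nat.rfindOpt_spec hy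
  rwa [hst l y hl] at hy

end OptimalMachine

/-- Optimal prefix-free machines exist. -/
theorem exists_isOptimalPrefixFreeMachine :
    ∃ U : List Bool →. List Bool, IsOptimalPrefixFreeMachine U := by
  refine ⟨OptimalMachine.machine,
    ⟨OptimalMachine.machine_partrec, OptimalMachine.machine_prefixFree⟩, fun M hM => ?_⟩
  obtain ⟨e, he⟩ := OptimalMachine.run_complete hM
  refine ⟨e + 1, fun σ x hx => ⟨List.replicate e true ++ false :: σ, ?_, ?_⟩⟩
  · exact Part.mem_bind_iff.2
      ⟨(e, σ), Part.mem_coe.2 (OptimalMachine.parse_eq_some.2 rfl), he σ x hx⟩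
  · simp
    omega

/-!
By Levin's coding theorem, the probability that a universal prefix-free machine outputs some string
of length `n` is at most a constant times `2 ^ (-K(n))`, so that the weights `2 ^ (K(n) - K(x))` of
the strings `x` of length `n` have bounded sum. Gibbs' inequality then shows that the entropy at
level `n` of any part `ν` of `μ` is at most the `ν`-average of `K(x) - K(n)` up to a constant, which
`K`-triviality bounds independently of `n`. But compactness makes the cylinders of an atomless `ν`
uniformly small, so the entropy of an atomless `ν` of positive mass tends to infinity with `n`.
Hence the atomless part of `μ` vanishes.
-/

open scoped ENNReal NNReal

section RecursivelyEnumerable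

variable {α β : Type*} [Primcodable α] [Primcodable β] {p : α → Prop}

theorem exists_primrecRel_mem_iff {f : α →. β} (hf : Partrec f) :
    ∃ g : α × β → ℕ → Prop, PrimrecRel g ∧ ∀ a b, b ∈ f a ↔ ∃ t, g (a, b) t := by
  obtain ⟨c, hc⟩ := Nat.Partrec.Code.exists_code.1 hf
  refine ⟨fun q t => c.evaln t (Encodable.encode q.1) = some (Encodable.encode q.2), ?_,
    fun a b => ?_⟩
  · exact Primrec.eq.comp
      (Nat.Partrec.Code.primrec_evaln.comp ((Primrec.snd.pair (Primrec.const c)).pair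
        (Primrec.encode.comp (Primrec.fst.comp Primrec.fst))))
      (Primrec.option_some.comp (Primrec.encode.comp (Primrec.snd.comp Primrec.fst)))
  · have heval : Encodable.encode b ∈ c.eval (Encodable.encode a) ↔ b ∈ f a := by
      rw [hc]
      simp
    rw [← heval, Nat.Partrec.Code.evaln_complete]
    rfl

theorem rePred_iff_exists_primrecRel :
    REPred p ↔ ∃ g : α → ℕ → Prop, PrimrecRel g ∧ ∀ a, p a ↔ ∃ t, g a t := by
  constructor
  · intro hp
    obtain ⟨g, hg, hpg⟩ := exists_primrecRel_mem_iff hp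
    refine ⟨fun a t => g (a, ()) t,
      hg.comp (Primrec.fst.pair (Primrec.const ())) Primrec.snd, fun a => ?_⟩
    rw [← hpg]
    simp
  · rintro ⟨g, ⟨_, hg⟩, hpg⟩
    have : DecidableRel g := fun a t => ‹DecidablePred fun q : α × ℕ => g q.1 q.2› (a, t)
    have hfind : Partrec fun a => Nat.rfind fun t => Part.some (decide (g a t)) :=
      Partrec.rfind (Primrec.to_comp (hg.of_eq fun _ => by congr)).partrec
    exact hfind.dom_re.of_eq fun a => by
      simp only [hpg]
      exact Nat.rfind_dom.trans (by simp)

theorem rePred_mem {f : α →. β} (hf : Partrec f) : REPred fun q : α × β => q.2 ∈ f q.1 :=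
  rePred_iff_exists_primrecRel.2 <|
    let ⟨g, hg, hfg⟩ := exists_primrecRel_mem_iff hf
    ⟨g, hg, fun q => hfg q.1 q.2⟩

/-- A one-to-one primitive recursive enumeration of the elements satisfying `p`, in which `none`
stands for a stage that lists nothing. The bound on codes keeps the data of an element small
compared with its stage, so that partial sums over stages are dyadic rationals of known
denominator. -/
structure IsEnumeration (r : ℕ → Option α) (p : α → Prop) : Prop where
  primrec : Primrec r
  iff_exists : ∀ a, p a ↔ ∃ s, r s = some a
  injective : ∀ ⦃s t a⦄, r s = some a → r t = some a → s = t
  encode_le : ∀ ⦃s a⦄, r s = some a → Encodable.encode a ≤ s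

theorem exists_primrecRel_unique (hp : REPred p) :
    ∃ g : α → ℕ → Prop, PrimrecRel g ∧ (∀ a, p a ↔ ∃ t, g a t) ∧
      ∀ ⦃a t u⦄, g a t → g a u → t = u := by
  classical
  obtain ⟨g, hg, hpg⟩ := rePred_iff_exists_primrecRel.1 hp
  have hnone : PrimrecRel fun (t : ℕ) (a : α) => ∀ u < t, ¬ g a u :=
    (hg.swap.not.forall_mem_list.comp (Primrec.list_range.comp Primrec.fst) Primrec.snd).of_eq
      (by simp)
  refine ⟨fun a t => g a t ∧ ∀ u < t, ¬ g a u, hg.and hnone.swap, fun a => ?_, ?_⟩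
  · rw [hpg]
    exact ⟨fun h => ⟨Nat.find h, Nat.find_spec h, fun _ => Nat.find_min h⟩,
      fun ⟨t, ht, _⟩ => ⟨t, ht⟩⟩
  · rintro a t u ⟨ht, ht'⟩ ⟨hu, hu'⟩
    exact le_antisymm (not_lt.1 fun h => ht' u h hu) (not_lt.1 fun h => hu' t h ht)

theorem exists_isEnumeration (hp : REPred p) : ∃ r : ℕ → Option α, IsEnumeration r p := by
  classical
  obtain ⟨g, hg, hpg, hunique⟩ := exists_primrecRel_unique hp
  let r (s : ℕ) : Option α :=
    (Encodable.decode₂ α s.unpair.2).bind fun a => if g a s.unpair.1 then some a else none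
  have hr (s : ℕ) (a : α) : r s = some a ↔ ∃ t, g a t ∧ s = Nat.pair t (Encodable.encode a) := by
    simp only [r, Option.bind_eq_some_iff, Encodable.decode₂_eq_some, Option.ite_none_right_eq_some,
      Option.some.injEq]
    constructor
    · rintro ⟨_, hs, ht, rfl⟩
      exact ⟨s.unpair.1, ht, by rw [hs, Nat.pair_unpair]⟩
    · rintro ⟨t, ht, rfl⟩
      exact ⟨a, by simp, by simpa using ht, rfl⟩
  refine ⟨r, ⟨?_, fun a => ?_, fun s s' a hs hs' => ?_, fun s a hs => ?_⟩⟩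
  · exact Primrec.option_bind (Primrec.decode₂.comp (Primrec.snd.comp Primrec.unpair))
      (Primrec.ite (hg.comp Primrec.snd (Primrec.fst.comp (Primrec.unpair.comp Primrec.fst)))
        (Primrec.option_some.comp Primrec.snd) (Primrec.const none))
  · simp [hr, hpg]
  · obtain ⟨t, ht, rfl⟩ := (hr s a).1 hs
    obtain ⟨t', ht', rfl⟩ := (hr s' a).1 hs'
    rw [hunique ht ht']
  · obtain ⟨t, -, rfl⟩ := (hr s a).1 hs
    exact Nat.right_le_pair _ _

theorem IsEnumeration.tsum_eq {r : ℕ → Option α} (hr : IsEnumeration r p) (f : α → ℝ≥0∞) :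
    ∑' a : {a // p a}, f a = ∑' s, (r s).elim 0 f := by
  have hstage (a : {a // p a}) : ∃ s, r s = some a.1 := (hr.iff_exists a).1 a.2
  choose stage hs using hstage
  have hinj : Function.Injective stage := fun a b h =>
    Subtype.ext (Option.some.inj ((hs a).symm.trans (h ▸ hs b)))
  refine (tsum_congr fun a => ?_).trans (hinj.tsum_eq fun s hsupp => ?_)
  · rw [hs, Option.elim_some]
  · cases h : r s with
    | none => simp [h] at hsupp
    | some a => exact ⟨⟨a, (hr.iff_exists a).2 ⟨s, h⟩⟩, hr.injective (hs _) h⟩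

theorem exists_partrec_mem_iff {R : α → β → Prop} (hR : REPred fun q : α × β => R q.1 q.2)
    (hunique : ∀ ⦃a b c⦄, R a b → R a c → b = c) :
    ∃ f : α →. β, Partrec f ∧ ∀ a b, b ∈ f a ↔ R a b := by
  classical
  obtain ⟨r, hr⟩ := exists_isEnumeration hR
  let listed (a : α) (s : ℕ) : Option β :=
    (r s).bind fun q => if q.1 = a then some q.2 else none
  have hlisted : Primrec₂ listed :=
    Primrec.option_bind (hr.primrec.comp Primrec.snd)
      (Primrec.ite (Primrec.eq.comp (Primrec.fst.comp Primrec.snd)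
          (Primrec.fst.comp Primrec.fst))
        (Primrec.option_some.comp (Primrec.snd.comp Primrec.snd)) (Primrec.const none))
  have hmem (a : α) (b : β) : R a b ↔ ∃ s, b ∈ listed a s := by
    simp [listed, hr.iff_exists (a, b), Option.bind_eq_some_iff]
  refine ⟨fun a => Nat.rfindOpt (listed a), Partrec.rfindOpt hlisted.to_comp, fun a b => ?_⟩
  rw [hmem]
  refine ⟨Nat.rfindOpt_spec, fun hb => ?_⟩
  obtain ⟨s, hs⟩ := hb
  obtain ⟨c, hc⟩ := Part.dom_iff_mem.1 (Nat.rfindOpt_dom.2 ⟨s, b, hs⟩)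
  rwa [hunique ((hmem a b).2 ⟨s, hs⟩) ((hmem a c).2 (Nat.rfindOpt_spec hc))]

end RecursivelyEnumerable

section BinaryStrings

/-- The number with binary expansion `σ`, most significant digit first. -/
def binVal (σ : List Bool) : ℕ := Nat.ofDigits 2 (σ.reverse.map Bool.toNat)

theorem binVal_append (σ τ : List Bool) :
    binVal (σ ++ τ) = binVal σ * 2 ^ τ.length + binVal τ := by
  simp only [binVal, List.reverse_append, List.map_append, Nat.ofDigits_append, List.length_map,
    List.length_reverse]
  ring

theorem binVal_lt (σ : List Bool) : binVal σ < 2 ^ σ.length := by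
  refine (Nat.ofDigits_lt_base_pow_length one_lt_two fun d hd => ?_).trans_eq (by simp)
  obtain ⟨b, -, rfl⟩ := List.mem_map.1 hd
  exact Bool.toNat_lt b

theorem exists_binVal_eq {l v : ℕ} (h : v < 2 ^ l) : ∃ σ, σ.length = l ∧ binVal σ = v := by
  induction l generalizing v with
  | zero => exact ⟨[], rfl, (Nat.lt_one_iff.1 h).symm⟩
  | succ l ih =>
    obtain ⟨σ, hl, hv⟩ := ih (v := v / 2) (by omega)
    refine ⟨σ ++ [v.bodd], by simp [hl], ?_⟩
    rw [binVal_append, hv, List.length_singleton, pow_one, mul_comm]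
    simp [binVal, ← Nat.mod_two_of_bodd, Nat.div_add_mod]

theorem binVal_inj_of_length_eq {σ τ : List Bool} (hl : σ.length = τ.length)
    (hv : binVal σ = binVal τ) : σ = τ := by
  have hlt (ρ : List Bool) : ∀ d ∈ ρ.reverse.map Bool.toNat, d < 2 := fun d hd =>
    let ⟨b, _, hb⟩ := List.mem_map.1 hd
    hb ▸ Bool.toNat_lt b
  have hmap := Nat.ofDigits_inj_of_len_eq one_lt_two (by simpa using hl) (hlt σ) (hlt τ) hv
  exact List.reverse_injective (List.map_injective_iff.2 (by decide) hmap)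

theorem primrec_binVal : Primrec binVal := by
  have hfoldr : Primrec fun σ : List Bool =>
      (σ.reverse.map Bool.toNat).foldr (fun d v => d + 2 * v) 0 :=
    Primrec.list_foldr
      (Primrec.list_map Primrec.list_reverse ((Primrec.dom_finite Bool.toNat).comp Primrec.snd).to₂)
      (Primrec.const 0)
      (Primrec.nat_add.comp (Primrec.fst.comp Primrec.snd)
        (Primrec.nat_mul.comp (Primrec.const 2) (Primrec.snd.comp Primrec.snd))).to₂
  exact hfoldr.of_eq fun σ => by simp [binVal, Nat.ofDigits_eq_foldr]

theorem bits_binVal_true_cons (σ : List Bool) :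
    Nat.bits (binVal (true :: σ)) = (true :: σ).reverse := by
  induction σ using List.reverseRecOn with
  | nil => simp [binVal]
  | append_singleton σ b ih =>
    have hbit : binVal (true :: (σ ++ [b])) = Nat.bit b (binVal (true :: σ)) := by
      rw [← List.cons_append, binVal_append, Nat.bit_val]
      simp [binVal, mul_comm]
    have hne : binVal (true :: σ) ≠ 0 := by
      rintro h
      simp [h] at ih
    rw [hbit, Nat.bits_append_bit _ _ fun h => absurd h hne, ih]
    simp

theorem binVal_true_cons_eq_succ_iff {n : ℕ} {σ : List Bool} :
    binVal (true :: σ) = n + 1 ↔ natString n = σ := by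
  have hleft : ∀ σ m, binVal (true :: σ) = m + 1 → natString m = σ := fun σ m h => by
    simp [natString, ← h, bits_binVal_true_cons]
  refine ⟨hleft σ n, ?_⟩
  rintro rfl
  have hlog : 2 ^ Nat.log 2 (n + 1) ≤ n + 1 := Nat.pow_log_le_self 2 n.succ_ne_zero
  obtain ⟨τ, hl, hv⟩ := exists_binVal_eq (l := Nat.log 2 (n + 1))
    (v := n + 1 - 2 ^ Nat.log 2 (n + 1)) (by
      have := Nat.lt_pow_succ_log_self one_lt_two (n + 1)
      omega)
  have hτ : binVal (true :: τ) = n + 1 := by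
    rw [← List.singleton_append, binVal_append, hl, hv]
    simp [binVal, hlog]
  rwa [hleft τ n hτ]

theorem computable_natString : Computable natString := by
  have hgraph : REPred fun q : ℕ × List Bool => natString q.1 = q.2 :=
    (Primrec.eq.comp
      (primrec_binVal.comp (Primrec.list_cons.comp (Primrec.const true) Primrec.snd))
      (Primrec.succ.comp Primrec.fst)).computablePred.to_re.of_eq
        fun _ => binVal_true_cons_eq_succ_iff
  obtain ⟨f, hf, hmem⟩ := exists_partrec_mem_iff (R := fun n σ => natString n = σ) hgraph
    fun _ _ _ h h' => h.symm.trans h'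
  exact hf.of_eq fun n => Part.eq_some_iff.2 ((hmem n _).2 rfl)

end BinaryStrings

section DyadicIntervals

/-- The interval of the reals in `[0, 1)` whose binary expansion begins with `σ`; prefix-free sets
of strings correspond to disjoint families of such intervals. -/
def dyadicInterval (σ : List Bool) : Set ℝ :=
  Set.Ico ((binVal σ : ℝ) / 2 ^ σ.length) ((binVal σ + 1 : ℝ) / 2 ^ σ.length)

theorem dyadicInterval_nonempty (σ : List Bool) : (dyadicInterval σ).Nonempty :=
  Set.nonempty_Ico.2 (by gcongr; linarith)

theorem dyadicInterval_nil : dyadicInterval [] = Set.Ico 0 1 := by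
  simp [dyadicInterval, binVal]

theorem dyadicInterval_subset_of_isPrefix {σ τ : List Bool} (h : σ <+: τ) :
    dyadicInterval τ ⊆ dyadicInterval σ := by
  obtain ⟨ρ, rfl⟩ := h
  have hρ : (binVal ρ : ℝ) + 1 ≤ 2 ^ ρ.length := by exact_mod_cast binVal_lt ρ
  simp only [dyadicInterval, binVal_append, List.length_append, pow_add]
  push_cast
  apply Set.Ico_subset_Ico <;> rw [div_le_div_iff₀ (by positivity) (by positivity)]
  · have : (0 : ℝ) ≤ binVal ρ * 2 ^ σ.length := by positivity
    linarith
  · have : ((binVal ρ : ℝ) + 1) * 2 ^ σ.length ≤ 2 ^ ρ.length * 2 ^ σ.length := by gcongr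
    linarith

theorem eq_of_mem_dyadicInterval {σ τ : List Bool} {r : ℝ} (hl : σ.length = τ.length)
    (hσ : r ∈ dyadicInterval σ) (hτ : r ∈ dyadicInterval τ) : σ = τ := by
  rw [dyadicInterval, Set.mem_Ico, div_le_iff₀ (by positivity), lt_div_iff₀ (by positivity)]
    at hσ hτ
  rw [← hl] at hτ
  refine binVal_inj_of_length_eq hl (le_antisymm ?_ ?_) <;>
    rw [← Nat.lt_succ_iff, Nat.succ_eq_add_one, ← Nat.cast_lt (α := ℝ)] <;> push_cast
  · exact hσ.1.trans_lt hτ.2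
  · exact hτ.1.trans_lt hσ.2

theorem isPrefix_of_mem_dyadicInterval {σ τ : List Bool} {r : ℝ} (h : σ.length ≤ τ.length)
    (hσ : r ∈ dyadicInterval σ) (hτ : r ∈ dyadicInterval τ) : σ <+: τ := by
  have htake := dyadicInterval_subset_of_isPrefix (List.take_prefix σ.length τ) hτ
  exact List.prefix_iff_eq_take.2 (eq_of_mem_dyadicInterval (by simp [h]) hσ htake)

theorem volume_dyadicInterval (σ : List Bool) :
    volume (dyadicInterval σ) = (2⁻¹ : ℝ≥0∞) ^ σ.length := by
  rw [dyadicInterval, Real.volume_Ico, ← sub_div, add_sub_cancel_left, one_div,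
    ENNReal.ofReal_inv_of_pos (by positivity), ENNReal.ofReal_pow (by norm_num), ENNReal.inv_pow]
  simp

/-- **Kraft's inequality** -/
theorem tsum_two_inv_pow_length_le_one {S : Set (List Bool)}
    (hS : ∀ σ ∈ S, ∀ τ ∈ S, σ <+: τ → σ = τ) : ∑' σ : S, (2⁻¹ : ℝ≥0∞) ^ σ.1.length ≤ 1 := by
  have hdisj : Pairwise (Function.onFun Disjoint fun σ : S => dyadicInterval σ) := by
    refine fun σ τ hne => Set.disjoint_left.2 fun r hσ hτ => hne (Subtype.ext ?_)
    rcases le_total σ.1.length τ.1.length with h | h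
    · exact hS _ σ.2 _ τ.2 (isPrefix_of_mem_dyadicInterval h hσ hτ)
    · exact (hS _ τ.2 _ σ.2 (isPrefix_of_mem_dyadicInterval h hτ hσ)).symm
  calc ∑' σ : S, (2⁻¹ : ℝ≥0∞) ^ σ.1.length
      = volume (⋃ σ : S, dyadicInterval σ) := by
        rw [measure_iUnion hdisj fun σ => measurableSet_Ico]
        simp only [volume_dyadicInterval]
    _ ≤ volume (Set.Ico (0 : ℝ) 1) := by
        rw [← dyadicInterval_nil]
        exact measure_mono (Set.iUnion_subset fun σ =>
          dyadicInterval_subset_of_isPrefix List.nil_prefix)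
    _ = 1 := by simp

/-- The factor `2` is needed: an interval of length `2⁻¹ ^ l` may contain no dyadic interval of that
length. -/
theorem exists_dyadicInterval_subset {a b : ℝ} {l : ℕ} (ha : 0 ≤ a) (hb : b ≤ 1)
    (hab : a + 2 * 2⁻¹ ^ l ≤ b) : ∃ σ, σ.length = l ∧ dyadicInterval σ ⊆ Set.Ico a b := by
  set N : ℝ := 2 ^ l
  have hN : 0 < N := by positivity
  have hright : (⌈a * N⌉₊ : ℝ) + 1 ≤ b * N := by
    have hceil := Nat.ceil_lt_add_one (mul_nonneg ha hN.le)
    have hlen : (2⁻¹ : ℝ) ^ l * N = 1 := by simp [N]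
    nlinarith
  obtain ⟨σ, hl, hv⟩ := exists_binVal_eq (l := l) (v := ⌈a * N⌉₊) (by
    rw [← Nat.cast_lt (α := ℝ)]
    push_cast
    nlinarith)
  refine ⟨σ, hl, ?_⟩
  rw [dyadicInterval, hl, hv]
  exact Set.Ico_subset_Ico ((le_div_iff₀ hN).2 (Nat.le_ceil _)) ((div_le_iff₀ hN).2 hright)

end DyadicIntervals

section DyadicSums

variable {γ : Type*} [Primcodable γ]

theorem primrec_sum_range {f : γ → ℕ → ℕ} (hf : Primrec₂ f) {n : γ → ℕ} (hn : Primrec n) :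
    Primrec fun c => ∑ j ∈ Finset.range (n c), f c j := by
  have hrec : Primrec fun c => Nat.rec (motive := fun _ => ℕ) 0 (fun j m => m + f c j) (n c) :=
    Primrec.nat_rec' hn (Primrec.const 0) (Primrec.nat_add.comp (Primrec.snd.comp Primrec.snd)
      (hf.comp Primrec.fst (Primrec.fst.comp Primrec.snd))).to₂
  refine hrec.of_eq fun c => ?_
  induction n c with
  | zero => rfl
  | succ m ih => rw [Finset.sum_range_succ, ← ih]

theorem primrec₂_pow : Primrec₂ ((· ^ ·) : ℕ → ℕ → ℕ) :=
  Primrec₂.unpaired'.1 Nat.Primrec.pow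

/-- The sum of `2⁻¹ ^ l` over the lengths `l` listed by `w` before stage `s`. -/
noncomputable def partialWeight (w : ℕ → Option ℕ) (s : ℕ) : ℝ≥0 :=
  ∑ j ∈ Finset.range s, (w j).elim 0 (2⁻¹ ^ ·)

/-- The natural number `2 ^ s * partialWeight w s`, for a sequence `w` that lists no length before
the stage equal to it; this is what makes comparisons of partial weights computable. -/
def scaledWeight (w : ℕ → Option ℕ) (s : ℕ) : ℕ :=
  ∑ j ∈ Finset.range s, (w j).elim 0 fun l => 2 ^ (s - l)

theorem partialWeight_succ (w : ℕ → Option ℕ) (s : ℕ) :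
    partialWeight w (s + 1) = partialWeight w s + (w s).elim 0 (2⁻¹ ^ ·) :=
  Finset.sum_range_succ _ _

theorem partialWeight_mono (w : ℕ → Option ℕ) : Monotone (partialWeight w) :=
  monotone_nat_of_le_succ fun s => by simp [partialWeight_succ]

theorem tsum_elim_eq_iSup_partialWeight (w : ℕ → Option ℕ) :
    ∑' s, (w s).elim 0 ((2⁻¹ : ℝ≥0∞) ^ ·) = ⨆ s, (partialWeight w s : ℝ≥0∞) := by
  have hcast (s : ℕ) :
      (partialWeight w s : ℝ≥0∞) = ∑ j ∈ Finset.range s, (w j).elim 0 ((2⁻¹ : ℝ≥0∞) ^ ·) := by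
    rw [partialWeight, ENNReal.ofNNReal_finsetSum]
    refine Finset.sum_congr rfl fun j _ => ?_
    cases w j <;> simp [ENNReal.inv_pow]
  simp only [hcast, ENNReal.tsum_eq_iSup_nat]

theorem cast_scaledWeight {w : ℕ → Option ℕ} (hw : ∀ ⦃s l⦄, w s = some l → l ≤ s) (s : ℕ) :
    (scaledWeight w s : ℝ≥0) = 2 ^ s * partialWeight w s := by
  simp only [scaledWeight, partialWeight, Nat.cast_sum, Finset.mul_sum]
  refine Finset.sum_congr rfl fun j hj => ?_
  cases h : w j with
  | none => simp
  | some l =>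
    have hl : l ≤ s := (hw h).trans (Finset.mem_range.1 hj).le
    simp [pow_sub₀ (2 : ℝ≥0) two_ne_zero hl]

theorem primrec₂_scaledWeight {w : γ → ℕ → Option ℕ} (hw : Primrec₂ w) :
    Primrec₂ fun c s => scaledWeight (w c) s := by
  refine primrec_sum_range (γ := γ × ℕ)
    (f := fun q j => (w q.1 j).elim 0 fun l => 2 ^ (q.2 - l)) ?_ Primrec.snd
  have hcases := Primrec.option_casesOn
    (hw.comp ((Primrec.fst (α := γ) (β := ℕ)).comp Primrec.fst) Primrec.snd)
    (Primrec.const 0)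
    (primrec₂_pow.comp (Primrec.const 2) (Primrec.nat_sub.comp
      (Primrec.snd.comp (Primrec.fst.comp Primrec.fst)) Primrec.snd)).to₂
  exact hcases.of_eq fun q => by cases h : w q.1.1 q.2 <;> simp [h]

end DyadicSums

section MachineExistence

variable {β : Type*} {w : ℕ → Option ℕ}

/-- Prefix-freeness of the domain of a machine whose outputs need not be strings. -/
def HasPrefixFreeDomain (M : List Bool →. β) : Prop :=
  ∀ σ τ : List Bool, (M σ).Dom → (M τ).Dom → σ <+: τ → σ = τ

/-- The interval allotted to the length listed by `w` at stage `s`: twice as long as the requested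
dyadic interval, and adjacent to the interval of the next stage. -/
noncomputable def allottedInterval (w : ℕ → Option ℕ) (s : ℕ) : Set ℝ :=
  Set.Ico (2 * partialWeight w s) (2 * partialWeight w (s + 1))

theorem pairwise_disjoint_allottedInterval (w : ℕ → Option ℕ) :
    Pairwise (Function.onFun Disjoint (allottedInterval w)) := by
  have hmono : Monotone fun s => (2 * partialWeight w s : ℝ) := fun s t h => by
    have : partialWeight w s ≤ partialWeight w t := partialWeight_mono w h
    dsimp only
    gcongr
  exact hmono.pairwise_disjoint_on_Ico_succ

theorem primrecRel_dyadicInterval_subset_allottedInterval (hw : Primrec w)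
    (hws : ∀ ⦃s l⦄, w s = some l → l ≤ s) :
    PrimrecRel fun σ s => dyadicInterval σ ⊆ allottedInterval w s := by
  have hN {f : List Bool × ℕ → ℕ} (hf : Primrec f) : Primrec fun q => scaledWeight w (f q) :=
    (primrec₂_scaledWeight (hw.comp Primrec.snd).to₂).comp (Primrec.const ()) hf
  have hpow {f : List Bool × ℕ → ℕ} (hf : Primrec f) : Primrec fun q => 2 ^ f q :=
    primrec₂_pow.comp (Primrec.const 2) hf
  have hlen := hpow (Primrec.list_length.comp Primrec.fst)
  have hval : Primrec fun q : List Bool × ℕ => binVal q.1 := primrec_binVal.comp Primrec.fst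
  have hsucc : Primrec fun q : List Bool × ℕ => q.2 + 1 := Primrec.succ.comp Primrec.snd
  have hleft := Primrec.nat_le.comp
    (Primrec.nat_mul.comp (Primrec.nat_mul.comp (Primrec.const 2) (hN Primrec.snd)) hlen)
    (Primrec.nat_mul.comp hval (hpow Primrec.snd))
  have hright := Primrec.nat_le.comp
    (Primrec.nat_mul.comp (Primrec.succ.comp hval) (hpow hsucc))
    (Primrec.nat_mul.comp (Primrec.nat_mul.comp (Primrec.const 2) (hN hsucc)) hlen)
  refine (hleft.and hright).of_eq fun (σ, s) => Iff.symm ?_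
  have hS (s : ℕ) : (partialWeight w s : ℝ) = scaledWeight w s / 2 ^ s := by
    rw [eq_div_iff (by positivity), mul_comm]
    exact_mod_cast (cast_scaledWeight hws s).symm
  refine (Set.Ico_subset_Ico_iff (Set.nonempty_Ico.1 (dyadicInterval_nonempty σ))).trans ?_
  rw [hS, hS, mul_div_assoc', mul_div_assoc', div_le_div_iff₀ (by positivity) (by positivity),
    div_le_div_iff₀ (by positivity) (by positivity)]
  norm_cast

theorem exists_dyadicInterval_subset_allottedInterval
    (hsum : ∑' s, (w s).elim 0 ((2⁻¹ : ℝ≥0∞) ^ ·) ≤ 2⁻¹) {s l : ℕ} (hs : w s = some l) :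
    ∃ σ : List Bool, σ.length = l ∧ dyadicInterval σ ⊆ allottedInterval w s := by
  have hle : (partialWeight w (s + 1) : ℝ) ≤ 2⁻¹ := by
    have h := (le_iSup (fun s => (partialWeight w s : ℝ≥0∞)) (s + 1)).trans
      ((tsum_elim_eq_iSup_partialWeight w).symm.trans_le hsum)
    rw [← ENNReal.coe_two, ← ENNReal.coe_inv two_ne_zero, ENNReal.coe_le_coe] at h
    exact_mod_cast h
  refine exists_dyadicInterval_subset (by positivity) (by linarith) ?_
  simp [partialWeight_succ, hs, mul_add]

theorem eq_of_isPrefix_of_dyadicInterval_subset {σ τ : List Bool} {s t : ℕ}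
    (hσ : dyadicInterval σ ⊆ allottedInterval w s) (hτ : dyadicInterval τ ⊆ allottedInterval w t)
    (h : σ <+: τ) : s = t := by
  obtain ⟨x, hx⟩ := dyadicInterval_nonempty τ
  exact (pairwise_disjoint_allottedInterval w).eq (Set.not_disjoint_iff.2
    ⟨x, hσ (dyadicInterval_subset_of_isPrefix h hx), hτ hx⟩)

/-- **Machine existence theorem** (Kraft–Chaitin) -/
theorem exists_machine_of_tsum_le [Primcodable β] {W : ℕ × β → Prop} (hW : REPred W)
    (hsum : ∑' p : {p // W p}, (2⁻¹ : ℝ≥0∞) ^ p.1.1 ≤ 2⁻¹) :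
    ∃ M : List Bool →. β, Partrec M ∧ HasPrefixFreeDomain M ∧
      ∀ l b, W (l, b) → ∃ σ, b ∈ M σ ∧ σ.length = l := by
  obtain ⟨r, hr⟩ := exists_isEnumeration hW
  let w (s : ℕ) : Option ℕ := (r s).map Prod.fst
  have hw : Primrec w := Primrec.option_map hr.primrec (Primrec.fst.comp Primrec.snd).to₂
  have hws : ∀ ⦃s l⦄, w s = some l → l ≤ s := fun s l h => by
    obtain ⟨p, hp, rfl⟩ := Option.map_eq_some_iff.1 h
    exact (Nat.left_le_pair _ _).trans (hr.encode_le hp)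
  have hwsum : ∑' s, (w s).elim 0 ((2⁻¹ : ℝ≥0∞) ^ ·) ≤ 2⁻¹ := by
    refine (tsum_congr fun s => ?_).trans_le
      ((hr.tsum_eq fun p => (2⁻¹ : ℝ≥0∞) ^ p.1).symm.trans_le hsum)
    cases h : r s <;> simp [w, h]
  let g (q : List Bool × β) (s : ℕ) : Prop :=
    r s = some (q.1.length, q.2) ∧ dyadicInterval q.1 ⊆ allottedInterval w s
  have hg : PrimrecRel g := PrimrecPred.and
    (Primrec.eq.comp (hr.primrec.comp Primrec.snd)
      (Primrec.option_some.comp ((Primrec.list_length.comp (Primrec.fst.comp Primrec.fst)).pair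
        (Primrec.snd.comp Primrec.fst))))
    ((primrecRel_dyadicInterval_subset_allottedInterval hw hws).comp
      (Primrec.fst.comp Primrec.fst) Primrec.snd)
  obtain ⟨M, hM, hmem⟩ := exists_partrec_mem_iff (R := fun σ b => ∃ s, g (σ, b) s)
    (rePred_iff_exists_primrecRel.2 ⟨g, hg, fun _ => Iff.rfl⟩)
    fun σ b c ⟨s, hb, hs⟩ ⟨t, hc, ht⟩ => by
      obtain rfl := eq_of_isPrefix_of_dyadicInterval_subset hs ht List.prefix_rfl
      exact congrArg Prod.snd (Option.some.inj (hb.symm.trans hc))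
  refine ⟨M, hM, fun σ τ hσ hτ h => ?_, fun l b hlb => ?_⟩
  · obtain ⟨b, s, hb, hs⟩ := (Part.dom_iff_mem.1 hσ).imp fun b => (hmem σ b).1
    obtain ⟨c, t, hc, ht⟩ := (Part.dom_iff_mem.1 hτ).imp fun c => (hmem τ c).1
    obtain rfl := eq_of_isPrefix_of_dyadicInterval_subset hs ht h
    exact h.eq_of_length (congrArg Prod.fst (Option.some.inj (hb.symm.trans hc)))
  · obtain ⟨s, hs⟩ := (hr.iff_exists _).1 hlb
    obtain ⟨σ, rfl, hσ⟩ := exists_dyadicInterval_subset_allottedInterval hwsum (s := s) (l := l)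
      (by simp [w, hs])
    exact ⟨σ, (hmem _ _).2 ⟨s, hs, hσ⟩, rfl⟩

end MachineExistence

section CodingTheorem

variable {U : List Bool →. List Bool}

theorem prefixComplexity_le {σ x : List Bool} (h : x ∈ U σ) : prefixComplexity U x ≤ σ.length :=
  Nat.sInf_le ⟨σ, h, rfl⟩

variable {β : Type*} {M : List Bool →. β} {f : β → List Bool}

/-- The probability that the prefix-free machine `M`, fed with independent fair bits, halts with
output `b`. -/
noncomputable def outputProbability (M : List Bool →. β) (b : β) : ℝ≥0∞ :=
  ∑' σ : {σ // b ∈ M σ}, 2⁻¹ ^ σ.1.length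

theorem tsum_outputProbability_le_one (hfree : HasPrefixFreeDomain M) :
    ∑' b, outputProbability M b ≤ 1 := by
  let input (p : Σ b, {σ // b ∈ M σ}) : {σ | (M σ).Dom} := ⟨p.2.1, Part.dom_iff_mem.2 ⟨p.1, p.2.2⟩⟩
  have hinput : Function.Injective input := by
    rintro ⟨b, σ, hσ⟩ ⟨c, τ, hτ⟩ h
    obtain rfl : σ = τ := congrArg Subtype.val h
    obtain rfl := Part.mem_unique hσ hτ
    rfl
  calc ∑' b, outputProbability M b
      = ∑' p, (2⁻¹ : ℝ≥0∞) ^ (input p).1.length :=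
      (ENNReal.tsum_sigma' fun p => (2⁻¹ : ℝ≥0∞) ^ (input p).1.length).symm
    _ ≤ ∑' σ : {σ | (M σ).Dom}, (2⁻¹ : ℝ≥0∞) ^ σ.1.length :=
      ENNReal.tsum_comp_le_tsum_of_injective hinput _
    _ ≤ 1 := tsum_two_inv_pow_length_le_one fun σ hσ τ hτ => hfree σ τ hσ hτ

theorem tsum_two_inv_pow_le_half (q : ℝ≥0∞) :
    ∑' l : {l : ℕ // 4 * 2⁻¹ ^ l < q}, (2⁻¹ : ℝ≥0∞) ^ l.1 ≤ q / 2 := by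
  classical
  by_cases hex : ∃ l : ℕ, 4 * 2⁻¹ ^ l < q
  · let l₀ := Nat.find hex
    have hl₀ (l : {l : ℕ // 4 * 2⁻¹ ^ l < q}) : l₀ ≤ l.1 := Nat.find_min' hex l.2
    have hinj : Function.Injective fun l : {l : ℕ // 4 * 2⁻¹ ^ l < q} => l.1 - l₀ :=
      fun l m h => Subtype.ext (tsub_left_inj (hl₀ l) (hl₀ m) |>.1 h)
    calc ∑' l : {l : ℕ // 4 * 2⁻¹ ^ l < q}, (2⁻¹ : ℝ≥0∞) ^ l.1
        = ∑' l : {l : ℕ // 4 * 2⁻¹ ^ l < q}, (2⁻¹ : ℝ≥0∞) ^ (l.1 - l₀ + l₀) :=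
        tsum_congr fun l => by rw [Nat.sub_add_cancel (hl₀ l)]
      _ ≤ ∑' k : ℕ, (2⁻¹ : ℝ≥0∞) ^ (k + l₀) :=
        ENNReal.tsum_comp_le_tsum_of_injective hinj fun k => (2⁻¹ : ℝ≥0∞) ^ (k + l₀)
      _ = 2 * 2⁻¹ ^ l₀ := by
        simp only [pow_add, ENNReal.tsum_mul_right, ENNReal.tsum_geometric,
          ENNReal.one_sub_inv_two, inv_inv]
      _ ≤ q / 2 := by
        rw [ENNReal.le_div_iff_mul_le (by simp) (by simp), mul_right_comm]
        norm_num1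
        exact (Nat.find_spec hex).le
  · have : IsEmpty {l : ℕ // 4 * 2⁻¹ ^ l < q} := Subtype.isEmpty_of_false (not_exists.1 hex)
    simp

theorem tsum_two_inv_pow_lt_outputProbability_le_half (hfree : HasPrefixFreeDomain M) :
    ∑' p : {p : ℕ × β // 4 * 2⁻¹ ^ p.1 < outputProbability M p.2}, (2⁻¹ : ℝ≥0∞) ^ p.1.1 ≤ 2⁻¹ := by
  let swap (p : {p : ℕ × β // 4 * 2⁻¹ ^ p.1 < outputProbability M p.2}) :
      Σ b, {l : ℕ // 4 * 2⁻¹ ^ l < outputProbability M b} := ⟨p.1.2, p.1.1, p.2⟩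
  have hswap : Function.Injective swap := by
    rintro ⟨⟨l, b⟩, hl⟩ ⟨⟨m, c⟩, hm⟩ h
    obtain ⟨rfl, h⟩ := Sigma.mk.inj h
    obtain rfl : l = m := congrArg Subtype.val (eq_of_heq h)
    rfl
  calc ∑' p : {p : ℕ × β // 4 * 2⁻¹ ^ p.1 < outputProbability M p.2}, (2⁻¹ : ℝ≥0∞) ^ p.1.1
      ≤ ∑' q : Σ b, {l : ℕ // 4 * 2⁻¹ ^ l < outputProbability M b}, (2⁻¹ : ℝ≥0∞) ^ q.2.1 :=
      ENNReal.tsum_comp_le_tsum_of_injective hswap fun q => (2⁻¹ : ℝ≥0∞) ^ q.2.1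
    _ = ∑' b, ∑' l : {l : ℕ // 4 * 2⁻¹ ^ l < outputProbability M b}, (2⁻¹ : ℝ≥0∞) ^ l.1 :=
      ENNReal.tsum_sigma' _
    _ ≤ ∑' b, outputProbability M b / 2 := ENNReal.tsum_le_tsum fun b => tsum_two_inv_pow_le_half _
    _ ≤ 2⁻¹ := by
      simp only [div_eq_mul_inv, ENNReal.tsum_mul_right]
      exact mul_le_of_le_one_left' (tsum_outputProbability_le_one hfree)

variable [Primcodable β]

theorem exists_outputProbability_eq_iSup_partialWeight (hM : Partrec M) :
    ∃ w : β → ℕ → Option ℕ, Primrec₂ w ∧ (∀ ⦃b s l⦄, w b s = some l → l ≤ s) ∧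
      ∀ b, outputProbability M b = ⨆ s, (partialWeight (w b) s : ℝ≥0∞) := by
  classical
  obtain ⟨r, hr⟩ := exists_isEnumeration (rePred_mem hM)
  let w (b : β) (s : ℕ) : Option ℕ :=
    (r s).bind fun q => if q.2 = b then some q.1.length else none
  refine ⟨w, ?_, fun b s l h => ?_, fun b => ?_⟩
  · exact Primrec.option_bind (hr.primrec.comp Primrec.snd)
      (Primrec.ite (Primrec.eq.comp (Primrec.snd.comp Primrec.snd) (Primrec.fst.comp Primrec.fst))
        (Primrec.option_some.comp (Primrec.list_length.comp (Primrec.fst.comp Primrec.snd)))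
        (Primrec.const none))
  · obtain ⟨q, hq, h⟩ := Option.bind_eq_some_iff.1 h
    obtain ⟨-, rfl⟩ : q.2 = b ∧ q.1.length = l := by simpa using h
    exact (Encodable.length_le_encode _).trans ((Nat.left_le_pair _ _).trans (hr.encode_le hq))
  · let weight (q : List Bool × β) : ℝ≥0∞ := if q.2 = b then 2⁻¹ ^ q.1.length else 0
    let graphPoint (σ : {σ // b ∈ M σ}) : {q : List Bool × β // q.2 ∈ M q.1} := ⟨(σ.1, b), σ.2⟩
    have hinj : Function.Injective graphPoint := fun σ τ h =>
      Subtype.ext (congrArg (fun q => q.1.1) h)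
    calc outputProbability M b = ∑' σ, weight (graphPoint σ) :=
          tsum_congr fun σ => (if_pos rfl).symm
      _ = ∑' q : {q : List Bool × β // q.2 ∈ M q.1}, weight q := by
          refine hinj.tsum_eq (f := fun q => weight q) fun q hq => ?_
          obtain rfl : q.1.2 = b := by_contra fun h => hq (if_neg h)
          exact ⟨⟨q.1.1, q.2⟩, rfl⟩
      _ = ∑' s, (w b s).elim 0 ((2⁻¹ : ℝ≥0∞) ^ ·) := by
          refine (hr.tsum_eq weight).trans (tsum_congr fun s => ?_)
          cases h : r s with
          | none => simp [w, h]
          | some q => by_cases hq : q.2 = b <;> simp [w, weight, h, hq]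
      _ = _ := tsum_elim_eq_iSup_partialWeight _

theorem rePred_lt_outputProbability (hM : Partrec M) :
    REPred fun q : ℕ × β => 4 * 2⁻¹ ^ q.1 < outputProbability M q.2 := by
  obtain ⟨w, hw, hws, hQ⟩ := exists_outputProbability_eq_iSup_partialWeight hM
  refine rePred_iff_exists_primrecRel.2
    ⟨fun q s => 4 * 2 ^ s < scaledWeight (w q.2) s * 2 ^ q.1, ?_, fun q => ?_⟩
  · exact Primrec.nat_lt.comp
      (Primrec.nat_mul.comp (Primrec.const 4) (primrec₂_pow.comp (Primrec.const 2) Primrec.snd))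
      (Primrec.nat_mul.comp
        ((primrec₂_scaledWeight hw).comp (Primrec.snd.comp Primrec.fst) Primrec.snd)
        (primrec₂_pow.comp (Primrec.const 2) (Primrec.fst.comp Primrec.fst)))
  · rw [hQ, lt_iSup_iff]
    refine exists_congr fun s => ?_
    have hcoe : (4 * 2⁻¹ ^ q.1 : ℝ≥0∞) = ((4 * 2⁻¹ ^ q.1 : ℝ≥0) : ℝ≥0∞) := by simp [ENNReal.inv_pow]
    rw [hcoe, ENNReal.coe_lt_coe, inv_pow, ← div_eq_mul_inv, div_lt_iff₀ (by positivity),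
      ← mul_lt_mul_iff_left₀ (show (0 : ℝ≥0) < 2 ^ s by positivity), mul_right_comm,
      mul_comm (partialWeight _ _), ← cast_scaledWeight (hws (b := q.2)) s]
    norm_cast

theorem IsOptimalPrefixFreeMachine.exists_prefixComplexity_le (hU : IsOptimalPrefixFreeMachine U)
    (hM : Partrec M) (hfree : HasPrefixFreeDomain M) (hf : Computable f) :
    ∃ d : ℕ, ∀ σ b, b ∈ M σ → prefixComplexity U (f b) ≤ σ.length + d := by
  obtain ⟨d, hd⟩ := hU.optimal (fun σ => (M σ).map f) ⟨hM.map (hf.comp Computable.snd).to₂, hfree⟩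
  refine ⟨d, fun σ b hb => ?_⟩
  obtain ⟨τ, hτ, hle⟩ := hd σ (f b) (Part.mem_map f hb)
  exact (prefixComplexity_le hτ).trans hle

/-- **Coding theorem** (Levin) -/
theorem IsOptimalPrefixFreeMachine.exists_outputProbability_le (hU : IsOptimalPrefixFreeMachine U)
    (hM : Partrec M) (hfree : HasPrefixFreeDomain M) (hf : Computable f) :
    ∃ d : ℕ, ∀ b, outputProbability M b ≤ 2 ^ d * 2⁻¹ ^ prefixComplexity U (f b) := by
  obtain ⟨N, hN, hNfree, hNW⟩ :=
    exists_machine_of_tsum_le (rePred_lt_outputProbability hM)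
      (tsum_two_inv_pow_lt_outputProbability_le_half hfree)
  obtain ⟨d, hd⟩ := hU.exists_prefixComplexity_le hN hNfree hf
  refine ⟨d + 3, fun b => ?_⟩
  have hcancel (k j : ℕ) : (2 : ℝ≥0∞) ^ (k + j) * 2⁻¹ ^ k = 2 ^ j := by
    rw [pow_add, mul_right_comm, ← mul_pow,
      ENNReal.mul_inv_cancel two_ne_zero ENNReal.ofNat_ne_top, one_pow, one_mul]
  rcases le_total (prefixComplexity U (f b)) (d + 1) with hK | hK
  · obtain ⟨j, hj⟩ := Nat.exists_eq_add_of_le (hK.trans (Nat.le_add_right _ 2))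
    rw [hj, hcancel]
    exact ((ENNReal.le_tsum b).trans (tsum_outputProbability_le_one hfree)).trans
      (one_le_pow₀ one_le_two)
  · by_contra! hlt
    obtain ⟨l, hl⟩ := Nat.exists_eq_add_of_le hK
    rw [hl, pow_add _ _ l, ← mul_assoc, hcancel (d + 1) 2] at hlt
    norm_num1 at hlt
    obtain ⟨σ, hσ, rfl⟩ := hNW l b hlt
    have := hd σ b hσ
    omega

end CodingTheorem

section ComplexityBound

variable {U : List Bool →. List Bool}

theorem IsOptimalPrefixFreeMachine.exists_sum_two_zpow_sub_le
    (hU : IsOptimalPrefixFreeMachine U) :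
    ∃ d : ℕ, ∀ n, ∑ x : Fin n → Bool,
      (2 : ℝ) ^ ((prefixComplexity U (natString n) : ℤ) - prefixComplexity U (List.ofFn x)) ≤
        2 ^ d := by
  have hlength : Partrec fun σ => (U σ).map List.length :=
    hU.machine.partrec.map (Computable.list_length.comp Computable.snd).to₂
  obtain ⟨d, hd⟩ := hU.exists_outputProbability_le hlength hU.machine.prefixFree
    computable_natString
  choose description hmem hlen using hU.exists_description
  refine ⟨d, fun n => ?_⟩
  let K (x : Fin n → Bool) : ℕ := prefixComplexity U (List.ofFn x)
  let input (x : Fin n → Bool) : {σ // n ∈ (U σ).map List.length} :=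
    ⟨description (List.ofFn x), (Part.mem_map_iff _).2 ⟨_, hmem _, List.length_ofFn⟩⟩
  have hinput : Function.Injective input := fun x y h => by
    have hdescription : description (List.ofFn x) = description (List.ofFn y) :=
      congrArg Subtype.val h
    exact List.ofFn_injective (Part.mem_unique (hmem _) (hdescription ▸ hmem _))
  have hsum : ∑ x, (2⁻¹ : ℝ≥0∞) ^ K x ≤ 2 ^ d * 2⁻¹ ^ prefixComplexity U (natString n) :=
    calc ∑ x, (2⁻¹ : ℝ≥0∞) ^ K x = ∑' x, (2⁻¹ : ℝ≥0∞) ^ (input x).1.length := by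
          rw [tsum_fintype]
          exact Finset.sum_congr rfl fun x _ => by rw [hlen]
      _ ≤ outputProbability (fun σ => (U σ).map List.length) n :=
          ENNReal.tsum_comp_le_tsum_of_injective hinput _
      _ ≤ _ := hd n
  have hreal : ∑ x, (2⁻¹ : ℝ) ^ K x ≤ 2 ^ d * 2⁻¹ ^ prefixComplexity U (natString n) := by
    have h := ENNReal.toReal_mono (by finiteness) hsum
    rw [ENNReal.toReal_sum (by finiteness)] at h
    simpa using h
  calc ∑ x, (2 : ℝ) ^ ((prefixComplexity U (natString n) : ℤ) - K x)
      = 2 ^ prefixComplexity U (natString n) * ∑ x, (2⁻¹ : ℝ) ^ K x := by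
        rw [Finset.mul_sum]
        exact Finset.sum_congr rfl fun x _ => by
          rw [zpow_sub₀ two_ne_zero, zpow_natCast, zpow_natCast, div_eq_mul_inv, inv_pow]
    _ ≤ 2 ^ prefixComplexity U (natString n) *
        (2 ^ d * 2⁻¹ ^ prefixComplexity U (natString n)) := by gcongr
    _ = 2 ^ d := by
        rw [mul_left_comm, ← mul_pow, mul_inv_cancel₀ two_ne_zero, one_pow, mul_one]

end ComplexityBound

section Measure

theorem sum_mul_log_inv_le {ι : Type*} {s : Finset ι} {v q : ι → ℝ} {δ : ℝ} (hδ : 0 < δ)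
    (hv : ∀ i ∈ s, 0 ≤ v i) (hvδ : ∀ i ∈ s, v i ≤ δ) (hq : ∀ i ∈ s, 0 < q i) :
    (∑ i ∈ s, v i) * Real.log δ⁻¹ ≤ ∑ i ∈ s, q i - ∑ i ∈ s, v i * Real.log (q i) := by
  rw [Finset.sum_mul, ← Finset.sum_sub_distrib]
  refine Finset.sum_le_sum fun i hi => le_sub_iff_add_le.2 ?_
  have hpos : 0 < q i / δ := div_pos (hq i hi) hδ
  calc v i * Real.log δ⁻¹ + v i * Real.log (q i) = v i * Real.log (q i / δ) := by
        rw [Real.log_div (hq i hi).ne' hδ.ne', Real.log_inv]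
        ring
    _ ≤ v i * (q i / δ) := by
        gcongr
        · exact hv i hi
        · exact Real.log_le_self hpos.le
    _ ≤ δ * (q i / δ) := by
        gcongr
        exact hvδ i hi
    _ = q i := mul_div_cancel₀ _ hδ.ne'

theorem cantorCylinder_ofFn {n : ℕ} (x : Fin n → Bool) :
    cantorCylinder (List.ofFn x) = (fun (Z : ℕ → Bool) (i : Fin n) => Z i) ⁻¹' {x} := by
  ext Z
  simp only [cantorCylinder, Set.mem_ofPred_eq, Set.mem_preimage, Set.mem_singleton_iff,
    funext_iff, List.getElem_ofFn, List.length_ofFn]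
  exact ⟨fun h i => h i i.2, fun h i hi => h ⟨i, hi⟩⟩

theorem measurableSet_cantorCylinder_ofFn {n : ℕ} (x : Fin n → Bool) :
    MeasurableSet (cantorCylinder (List.ofFn x)) := by
  rw [cantorCylinder_ofFn]
  exact (measurable_pi_lambda _ fun i => measurable_pi_apply _) (measurableSet_singleton x)

variable (ν : Measure (ℕ → Bool)) [IsFiniteMeasure ν]

theorem sum_measureReal_cantorCylinder (n : ℕ) :
    ∑ x : Fin n → Bool, ν.real (cantorCylinder (List.ofFn x)) = ν.real Set.univ := by
  have hmeas (x : Fin n → Bool) := measurableSet_cantorCylinder_ofFn x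
  simp only [cantorCylinder_ofFn] at hmeas ⊢
  rw [sum_measureReal_preimage_singleton _ fun x _ => hmeas x]
  simp

theorem antitone_cantorCylinder_ofFn (Z : ℕ → Bool) :
    Antitone fun n => cantorCylinder (List.ofFn fun i : Fin n => Z i) := fun m n hmn Y hY => by
  simp only [cantorCylinder_ofFn, Set.mem_preimage, Set.mem_singleton_iff, funext_iff] at hY ⊢
  exact fun i => hY (i.castLE hmn)

theorem iInter_cantorCylinder_ofFn (Z : ℕ → Bool) :
    ⋂ n, cantorCylinder (List.ofFn fun i : Fin n => Z i) = {Z} := by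
  ext Y
  simp only [cantorCylinder_ofFn, Set.mem_iInter, Set.mem_preimage, Set.mem_singleton_iff,
    funext_iff]
  exact ⟨fun h i => h (i + 1) (Fin.last i), fun h n i => h i⟩

theorem tendsto_measure_cantorCylinder (Z : ℕ → Bool) :
    Filter.Tendsto (fun n => ν (cantorCylinder (List.ofFn fun i : Fin n => Z i))) Filter.atTop
      (nhds (ν {Z})) := by
  rw [← iInter_cantorCylinder_ofFn Z]
  exact tendsto_measure_iInter_atTop
    (fun n => (measurableSet_cantorCylinder_ofFn _).nullMeasurableSet)
    (antitone_cantorCylinder_ofFn Z) ⟨0, measure_ne_top _ _⟩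

theorem eventually_forall_measure_cantorCylinder_lt [NullSingletonClass ν] {δ : ℝ≥0∞} (hδ : 0 < δ) :
    ∀ᶠ n in Filter.atTop, ∀ x : Fin n → Bool, ν (cantorCylinder (List.ofFn x)) < δ := by
  let small (n : ℕ) : Set (ℕ → Bool) :=
    {Z | ν (cantorCylinder (List.ofFn fun i : Fin n => Z i)) < δ}
  have hopen (n : ℕ) : IsOpen (small n) :=
    (isOpen_discrete {x : Fin n → Bool | ν (cantorCylinder (List.ofFn x)) < δ}).preimage
      (f := fun (Z : ℕ → Bool) (i : Fin n) => Z i) (by fun_prop)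
  have hmono : Monotone small := fun m n hmn Z hZ =>
    (measure_mono (antitone_cantorCylinder_ofFn Z hmn)).trans_lt hZ
  have hcover : Set.univ ⊆ ⋃ n, small n := fun Z _ => by
    have hlim := tendsto_measure_cantorCylinder ν Z
    rw [measure_singleton] at hlim
    exact Set.mem_iUnion.2 (hlim.eventually_lt_const hδ).exists
  obtain ⟨N, hN⟩ := isCompact_univ.elim_directed_cover small hopen hcover hmono.directed_le
  filter_upwards [Filter.eventually_ge_atTop N] with n hn x
  let Z (i : ℕ) : Bool := if h : i < n then x ⟨i, h⟩ else false
  have hZ : (fun i : Fin n => Z i) = x := by simp [Z]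
  have hsmall : Z ∈ small n := hmono hn (hN (Set.mem_univ Z))
  rwa [Set.mem_ofPred_eq, hZ] at hsmall

theorem nullSingletonClass_restrict_compl_measureAtoms (μ : Measure (ℕ → Bool)) :
    NullSingletonClass (μ.restrict (measureAtoms μ)ᶜ) := by
  refine ⟨fun Z => ?_⟩
  rw [Measure.restrict_apply (measurableSet_singleton Z)]
  by_cases hZ : μ {Z} = 0
  · exact measure_mono_null Set.inter_subset_left hZ
  · have hatom : Z ∈ measureAtoms μ := pos_iff_ne_zero.2 hZ
    rw [Set.singleton_inter_eq_empty.2 (Set.notMem_compl_iff.2 hatom), measure_empty]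

end Measure

section KTriviality

variable {U : List Bool →. List Bool} {μ : Measure (ℕ → Bool)} [IsProbabilityMeasure μ]

theorem sum_prefixComplexity_sub_mul_measureReal_le {ν : Measure (ℕ → Bool)} (hν : ν ≤ μ)
    {n d : ℕ} {c : ℝ} (hc : averageComplexity U μ n ≤ prefixComplexity U (natString n) + c)
    (hd : ∀ x : Fin n → Bool,
      prefixComplexity U (natString n) ≤ prefixComplexity U (List.ofFn x) + d) :
    ∑ x : Fin n → Bool, ((prefixComplexity U (List.ofFn x) : ℝ) -
      prefixComplexity U (natString n)) * ν.real (cantorCylinder (List.ofFn x)) ≤ c + d := by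
  let K (x : Fin n → Bool) : ℝ := prefixComplexity U (List.ofFn x)
  let Kₙ : ℝ := prefixComplexity U (natString n)
  have hK (x : Fin n → Bool) : 0 ≤ K x - Kₙ + d := by
    have : (prefixComplexity U (natString n) : ℝ) ≤ prefixComplexity U (List.ofFn x) + d :=
      mod_cast hd x
    linarith
  have hνμ (x : Fin n → Bool) :
      ν.real (cantorCylinder (List.ofFn x)) ≤ μ.real (cantorCylinder (List.ofFn x)) :=
    ENNReal.toReal_mono (measure_ne_top _ _) (hν _)
  calc ∑ x, (K x - Kₙ) * ν.real (cantorCylinder (List.ofFn x))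
      ≤ ∑ x, (K x - Kₙ + d) * μ.real (cantorCylinder (List.ofFn x)) :=
        Finset.sum_le_sum fun x _ => (mul_le_mul_of_nonneg_right
          (le_add_of_nonneg_right d.cast_nonneg) measureReal_nonneg).trans
          (mul_le_mul_of_nonneg_left (hνμ x) (hK x))
    _ = averageComplexity U μ n - Kₙ + d := by
        simp only [add_mul, sub_mul, Finset.sum_add_distrib, Finset.sum_sub_distrib,
          ← Finset.mul_sum, sum_measureReal_cantorCylinder, probReal_univ, mul_one,
          averageComplexity, K]
    _ ≤ c + d := by linarith

theorem IsOptimalPrefixFreeMachine.exists_measureReal_univ_mul_log_inv_le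
    (hU : IsOptimalPrefixFreeMachine U) :
    ∃ d : ℕ, ∀ {ν : Measure (ℕ → Bool)}, ν ≤ μ → ∀ {n : ℕ} {c δ : ℝ},
      averageComplexity U μ n ≤ prefixComplexity U (natString n) + c → 0 < δ →
      (∀ x : Fin n → Bool, ν.real (cantorCylinder (List.ofFn x)) ≤ δ) →
      ν.real Set.univ * Real.log δ⁻¹ ≤ 2 ^ d + (c + d) * Real.log 2 := by
  obtain ⟨d, hd⟩ := hU.exists_sum_two_zpow_sub_le
  refine ⟨d, fun {ν} hν {n c δ} hc hδ hνδ => ?_⟩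
  have := isFiniteMeasure_of_le μ hν
  let q (x : Fin n → Bool) : ℝ :=
    2 ^ ((prefixComplexity U (natString n) : ℤ) - prefixComplexity U (List.ofFn x))
  have hK (x : Fin n → Bool) :
      prefixComplexity U (natString n) ≤ prefixComplexity U (List.ofFn x) + d := by
    have hq : q x ≤ 2 ^ (d : ℤ) :=
      (Finset.single_le_sum (fun y _ => by positivity) (Finset.mem_univ x)).trans (hd n)
    have := (zpow_le_zpow_iff_right₀ (one_lt_two : (1 : ℝ) < 2)).1 hq
    omega
  have hentropy := sum_mul_log_inv_le (s := Finset.univ) hδ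
    (fun x _ => measureReal_nonneg) (fun x _ => hνδ x) (q := q) fun x _ => by positivity
  rw [sum_measureReal_cantorCylinder] at hentropy
  have hexcess := mul_le_mul_of_nonneg_right
    (sum_prefixComplexity_sub_mul_measureReal_le hν hc hK) (Real.log_nonneg one_le_two)
  have hlog : ∑ x, ν.real (cantorCylinder (List.ofFn x)) * Real.log (q x) =
      -((∑ x : Fin n → Bool, ((prefixComplexity U (List.ofFn x) : ℝ) -
        prefixComplexity U (natString n)) * ν.real (cantorCylinder (List.ofFn x))) *
          Real.log 2) := by
    rw [Finset.sum_mul, ← Finset.sum_neg_distrib]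
    refine Finset.sum_congr rfl fun x _ => ?_
    rw [Real.log_zpow]
    push_cast
    ring
  linarith [hd n]

theorem IsOptimalPrefixFreeMachine.measure_compl_measureAtoms_eq_zero
    (hU : IsOptimalPrefixFreeMachine U) {c : ℝ}
    (hμ : ∃ᶠ n in Filter.atTop,
      averageComplexity U μ n ≤ prefixComplexity U (natString n) + c) :
    μ (measureAtoms μ)ᶜ = 0 := by
  let ν := μ.restrict (measureAtoms μ)ᶜ
  have : NullSingletonClass ν := nullSingletonClass_restrict_compl_measureAtoms μ
  obtain ⟨d, hd⟩ := hU.exists_measureReal_univ_mul_log_inv_le (μ := μ)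
  have hbound (t : ℝ) : ν.real Set.univ * t ≤ 2 ^ d + (c + d) * Real.log 2 := by
    obtain ⟨n, hc, hn⟩ := (hμ.and_eventually (eventually_forall_measure_cantorCylinder_lt ν
      (ENNReal.ofReal_pos.2 (Real.exp_pos (-t))))).exists
    have h := hd Measure.restrict_le_self hc (Real.exp_pos (-t)) fun x =>
      ENNReal.toReal_le_of_le_ofReal (Real.exp_pos _).le (hn x).le
    rwa [← Real.exp_neg, neg_neg, Real.log_exp] at h
  have hzero : ν.real Set.univ = 0 := by
    by_contra hne
    have h := hbound ((2 ^ d + (c + d) * Real.log 2 + 1) / ν.real Set.univ)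
    rw [mul_div_cancel₀ _ hne] at h
    linarith
  rwa [measureReal_eq_zero_iff, Measure.restrict_apply_univ] at hzero

end KTriviality

theorem mainTheorem9_general (U : List Bool →. List Bool) (hU : IsOptimalPrefixFreeMachine U)
    (μ : Measure (ℕ → Bool)) [IsProbabilityMeasure μ]
    (hμ : ∃ c : ℝ, ∃ᶠ n in Filter.atTop,
      averageComplexity U μ n ≤ prefixComplexity U (natString n) + c) :
    (measureAtoms μ).Nonempty ∧ μ (measureAtoms μ)ᶜ = 0 := by
  obtain ⟨c, hc⟩ := hμ
  have hnull : μ (measureAtoms μ)ᶜ = 0 := hU.measure_compl_measureAtoms_eq_zero hc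
  refine ⟨Set.nonempty_iff_ne_empty.2 fun hempty => ?_, hnull⟩
  rw [hempty, Set.compl_empty, measure_univ] at hnull
  exact one_ne_zero hnull

theorem mainTheorem9 (U : List Bool →. List Bool) (hU : IsOptimalPrefixFreeMachine U)
    (μ : Measure (ℕ → Bool)) [IsProbabilityMeasure μ] (hμ : IsKTrivialMeasure U μ) :
    (measureAtoms μ).Nonempty ∧ μ (measureAtoms μ)ᶜ = 0 :=
  mainTheorem9_general U hU μ <|
    let ⟨c, hc⟩ := hμ
    ⟨c, Filter.Frequently.of_forall hc⟩
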